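/- Let $f(z)=\sum_{k=0}^\infty a_k z^k$ be an entire function with $a_k>0$ for all $k\ge 0$, and put $q_n=\dfrac{a_{n-1}^2}{a_{n-2}a_n}$ for $n\ge 2$. Suppose that $$2\sqrt[3]{2}\le q_2\le q_3\le q_4\le\cdots .$$ For $n\ge 2$ let $c_n$ be the infimum of the numbers $a^2$, $a>1$, for which the polynomial $\sum_{j=0}^n a^{-j^2}z^j$ belongs to the Laguerre--Pólya class, that is, the class of functions of the form $c z^s e^{-\alpha z^2+\beta z}\prod_k(1-z/x_k)e^{z/x_k}$ with a finite (possibly empty) or infinite product, $c,\alpha,\beta,x_k\in\mathbb R$, $\alpha\ge 0$, $x_k\ne 0$, $s\in\mathbb Z_{\ge 0}$, and $\sum_k x_k^{-2}<\infty$. (It is known that, for $a>1$, this polynomial is in the class if and only if $a^2\ge c_n$.) If there are integers $j_0\ge 2$ and $m_0\ge 1$ such that $q_{j_0}\ge c_{2m_0}$, then the number of nonreal zeros of $f$, counted with multiplicity, does not exceed $j_0+2m_0-2$. -/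

import Mathlib

/-- The Laguerre–Pólya class: functions of the form
`c zⁿ exp(-α z² + β z) ∏ₖ (1 - z / xₖ) exp(z / xₖ)` with `c, α, β, xₖ` real, `α ≥ 0`, `xₖ ≠ 0`
and `∑ₖ xₖ⁻² < ∞`. The index set `I` is an arbitrary subset of `ℕ`, so that the product may be
infinite, finite or empty. -/
def LaguerrePolya (f : ℂ → ℂ) : Prop :=
  ∃ (c α β : ℝ) (n : ℕ) (I : Set ℕ) (x : I → ℝ) (P : ℂ → ℂ),
    0 ≤ α ∧ (∀ k, x k ≠ 0) ∧ Summable (fun k => ((x k) ^ 2)⁻¹) ∧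
    (∀ z : ℂ, HasProd (fun k => (1 - z / (x k : ℂ)) * Complex.exp (z / (x k : ℂ))) (P z)) ∧
    ∀ z : ℂ, f z = (c : ℂ) * z ^ n * Complex.exp (-(α : ℂ) * z ^ 2 + (β : ℂ) * z) * P z

/-- The section `S_n(z, g_a) = ∑_{j=0}^n a^{-j²} z^j` of the partial theta function `g_a`. -/
noncomputable def partialThetaSection (a : ℝ) (n : ℕ) (z : ℂ) : ℂ :=
  ∑ j ∈ Finset.range (n + 1), ((a : ℂ) ^ (j ^ 2))⁻¹ * z ^ j

/-- The threshold constant `c_n` (`n ≥ 2`): the infimum of the values `a²`, `a > 1`, for which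
`S_n(·, g_a)` is in the Laguerre–Pólya class. -/
noncomputable def thetaConst (n : ℕ) : ℝ :=
  sInf {t : ℝ | ∃ a : ℝ, 1 < a ∧ t = a ^ 2 ∧ LaguerrePolya (partialThetaSection a n)}

/-- The second quotient `q_n = a_{n-1}² / (a_{n-2} a_n)` of the coefficients, for `n ≥ 2`. -/
noncomputable def secondQuotient (a : ℕ → ℝ) (n : ℕ) : ℝ :=
  a (n - 1) ^ 2 / (a (n - 2) * a n)

/-- The set of nonreal zeros of `f`. -/
def nonrealZeros (f : ℂ → ℂ) : Set ℂ := {z : ℂ | f z = 0 ∧ z.im ≠ 0}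

/-! Write `p k = a (k-1) / a k`, so that `p (k+1) = q (k+1) * p k`, and `N = j₀ + 2m₀ - 2`. The
proof finds infinitely many negative zeros `ξ i` with `|ξ i| ≤ p (N+i+1)`, and Jensen's formula then
leaves room for at most `N` nonreal zeros.

Signs (`exists_sign_pos`). If `p (n-1) ≤ y ≤ p n`, the moduli `a k * y^k` increase up to index `n-1`
and decrease from index `n` on. Cut the alternating series of `f (-y)` into the block of indices
`n-2m₀, ..., n` and two tails. Each tail alternates with monotone moduli and contributes with the
sign `(-1)^(n-1)`. The block, read downwards from index `n`, is a theta section with parameter `t =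
c_{2m₀}` whose terms are damped because the `q`'s are at least `t`. Since `t ≥ 3`, damping can only
lower the sum (`alternating_sum_le_thetaWindow`). So a point `u` where the section is nonpositive
(`exists_thetaWindow_nonpos`) fixes the sign of `f` at `-p n / u`, and consecutive `n` give opposite
signs.

Counting (`sum_order_nonreal_le`). On `|z| = R = p K`, `|f|` is at most four times the term of index
`K`, whose logarithm is `log (a 0) + ∑_{j ≤ K} log (R / p j)`. In Jensen's inequality the zeros `ξ
i`, `i < K - N`, absorb the summands with `j > N`. The nonreal zeros share `N log R + O(1)`, and `R`
is arbitrarily large. -/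

/-! ### Real-rooted polynomials and their power sums. -/

open Polynomial in
/-- A real polynomial with constant term `1` all of whose complex roots are real is a product of
factors `1 + y X` with `y ≠ 0` real. -/
theorem Polynomial.exists_eq_prod_one_add_C_mul_X (p : ℝ[X]) (h0 : p.coeff 0 = 1)
    (hreal : ∀ z : ℂ, (p.map Complex.ofRealHom).eval z = 0 → z.im = 0) :
    ∃ s : Multiset ℝ, (∀ y ∈ s, y ≠ 0) ∧ p = (s.map fun y => 1 + C y * X).prod := by
  set q := p.map Complex.ofRealHom with hq
  have hq0 : q.coeff 0 = 1 := by simp [hq, h0]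
  have hqne : q ≠ 0 := by
    intro h; rw [h] at hq0; simp at hq0
  have hprod := (IsAlgClosed.splits q).eq_prod_roots
  have hroot : ∀ r ∈ q.roots, r = ((r.re : ℝ) : ℂ) ∧ r ≠ 0 := by
    intro r hr
    have hr' : q.eval r = 0 := (mem_roots hqne).1 hr
    refine ⟨Complex.ext rfl (by simpa using hreal r hr'), ?_⟩
    rintro rfl
    rw [← coeff_zero_eq_eval_zero, hq0] at hr'
    exact one_ne_zero hr'
  have hfac : (q.roots.map (X - C ·)) =
      q.roots.map (fun r => C (-r) * (1 + C ((-(r.re)⁻¹ : ℝ) : ℂ) * X)) := by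
    refine Multiset.map_congr rfl fun r hr => ?_
    obtain ⟨h1, h2⟩ := hroot r hr
    have h3 : ((-(r.re)⁻¹ : ℝ) : ℂ) = -r⁻¹ := by rw [h1]; simp
    rw [h3, mul_add, ← mul_assoc, ← C_mul]
    simp [h2]; ring
  rw [hfac, Multiset.prod_map_mul] at hprod
  have hconst : ((q.roots.map fun r => C (-r)).prod : ℂ[X]) = C (q.roots.map (fun r => -r)).prod := by
    rw [map_multiset_prod, Multiset.map_map]; rfl
  rw [hconst, ← mul_assoc, ← C_mul] at hprod
  have hlead : q.leadingCoeff * (q.roots.map (fun r => -r)).prod = 1 := by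
    have h := congrArg (Polynomial.eval 0) hprod
    rw [← coeff_zero_eq_eval_zero, hq0, eval_mul, eval_C, eval_multiset_prod, Multiset.map_map] at h
    simpa using h.symm
  rw [hlead, C_1, one_mul] at hprod
  refine ⟨q.roots.map (fun r => -(r.re)⁻¹), ?_, ?_⟩
  · intro y hy
    obtain ⟨r, hr, rfl⟩ := Multiset.mem_map.1 hy
    obtain ⟨h1, h2⟩ := hroot r hr
    have : r.re ≠ 0 := by
      intro h; rw [h] at h1; exact h2 (by simpa using h1)
    simpa using this
  · apply Polynomial.map_injective Complex.ofRealHom Complex.ofRealHom.injective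
    change q = _
    rw [Polynomial.map_multiset_prod, Multiset.map_map, Multiset.map_map]
    conv_lhs => rw [hprod]
    congr 1
    refine Multiset.map_congr rfl fun r _ => ?_
    simp

open Polynomial in
/-- Newton's identities for the first three power sums. -/
theorem Multiset.powerSums_of_prod_one_add_C_mul_X (s : Multiset ℝ) :
    ((s.map fun y => 1 + C y * X).prod : ℝ[X]).coeff 0 = 1 ∧
    s.sum = ((s.map fun y => 1 + C y * X).prod : ℝ[X]).coeff 1 ∧
    (s.map fun y => y ^ 2).sum = ((s.map fun y => 1 + C y * X).prod : ℝ[X]).coeff 1 ^ 2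
      - 2 * ((s.map fun y => 1 + C y * X).prod : ℝ[X]).coeff 2 ∧
    (s.map fun y => y ^ 3).sum = ((s.map fun y => 1 + C y * X).prod : ℝ[X]).coeff 1 ^ 3
      - 3 * ((s.map fun y => 1 + C y * X).prod : ℝ[X]).coeff 1 *
        ((s.map fun y => 1 + C y * X).prod : ℝ[X]).coeff 2
      + 3 * ((s.map fun y => 1 + C y * X).prod : ℝ[X]).coeff 3 := by
  induction s using Multiset.induction with
  | empty => simp [coeff_one]
  | cons y s ih =>
    simp only [Multiset.map_cons, Multiset.prod_cons, Multiset.sum_cons]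
    set P : ℝ[X] := (s.map fun y => 1 + C y * X).prod
    obtain ⟨h0, h1, h2, h3⟩ := ih
    have e0 : ((1 + C y * X) * P).coeff 0 = P.coeff 0 := by simp [add_mul, mul_assoc]
    have e : ∀ n, ((1 + C y * X) * P).coeff (n + 1) = P.coeff (n + 1) + y * P.coeff n := by
      intro n; rw [add_mul, one_mul, coeff_add, mul_assoc, coeff_C_mul, coeff_X_mul]
    rw [e0, e 0, e 1, e 2, h1, h2, h3, h0]
    norm_num
    refine ⟨?_, ?_, ?_⟩ <;> ring

/-! ### Zeros of Laguerre–Pólya functions. -/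

/-- A convergent product `∏ (1 - z / xₖ) exp (z / xₖ)` with `∑ xₖ⁻² < ∞` vanishes only at
the `xₖ`. -/
theorem exists_eq_of_hasProd_eq_zero {ι : Type*} {x : ι → ℝ} (hx : ∀ k, x k ≠ 0)
    (hs : Summable fun k => ((x k) ^ 2)⁻¹) {z : ℂ}
    (hp : HasProd (fun k => (1 - z / (x k : ℂ)) * Complex.exp (z / (x k : ℂ))) 0) :
    ∃ k, z = x k := by
  by_contra! hne
  have hx' : ∀ k, (x k : ℂ) ≠ 0 := fun k => Complex.ofReal_ne_zero.2 (hx k)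
  set g : ι → ℂ := fun k => (1 - z / (x k : ℂ)) * Complex.exp (z / (x k : ℂ)) - 1 with hg
  have hfun : (fun k => (1 - z / (x k : ℂ)) * Complex.exp (z / (x k : ℂ))) = fun k => 1 + g k := by
    funext k; simp [hg]
  have hsum : Summable fun k => ‖z / (x k : ℂ)‖ ^ 2 := by
    refine (hs.mul_left (‖z‖ ^ 2)).congr fun k => ?_
    rw [norm_div, div_pow, Complex.norm_real, Real.norm_eq_abs, sq_abs, div_eq_mul_inv]
  have hsmall : ∀ᶠ k in Filter.cofinite, ‖z / (x k : ℂ)‖ ≤ 1 := by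
    filter_upwards [hsum.tendsto_cofinite_zero.eventually (gt_mem_nhds one_pos)] with k hk
    nlinarith [norm_nonneg (z / (x k : ℂ))]
  have hgs : Summable (‖g ·‖) := by
    refine Summable.of_norm_bounded_eventually (hsum.mul_left 3) ?_
    filter_upwards [hsmall] with k hk
    set w := z / (x k : ℂ)
    have h1 := Complex.norm_exp_sub_one_sub_id_le hk
    -- The linear terms of `1 - w` and `exp w` cancel, so `g k` is quadratic in `w` and the product
    -- converges absolutely. Such a product vanishes only if a factor does.
    have h2 : g k = (1 - w) * (Complex.exp w - 1 - w) - w ^ 2 := by simp only [hg, w]; ring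
    have h3 : ‖(1 : ℂ) - w‖ ≤ 2 := (norm_sub_le _ _).trans (by rw [norm_one]; linarith)
    rw [norm_norm, h2]
    calc _ ≤ ‖1 - w‖ * ‖Complex.exp w - 1 - w‖ + ‖w‖ ^ 2 := by
          refine (norm_sub_le _ _).trans ?_
          rw [norm_mul, norm_pow]
      _ ≤ 2 * ‖w‖ ^ 2 + ‖w‖ ^ 2 := by gcongr
      _ = _ := by ring
  rw [hfun] at hp
  refine tprod_one_add_ne_zero_of_summable (fun k => ?_) hgs hp.tprod_eq
  have : 1 + g k = (1 - z / (x k : ℂ)) * Complex.exp (z / (x k : ℂ)) := by simp [hg]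
  rw [this]
  refine mul_ne_zero (fun h => hne k ?_) (Complex.exp_ne_zero _)
  have h1 : z / (x k : ℂ) = 1 := (sub_eq_zero.1 h).symm
  exact (div_eq_one_iff_eq (hx' k)).1 h1

/-- The zeros of a Laguerre–Pólya function which is not identically zero are real. -/
theorem LaguerrePolya.im_eq_zero {f : ℂ → ℂ} (hf : LaguerrePolya f) {w z : ℂ} (hw : f w ≠ 0)
    (hz : f z = 0) : z.im = 0 := by
  obtain ⟨c, α, β, n, I, x, P, -, hx, hs, hP, hfP⟩ := hf
  have hc : (c : ℂ) ≠ 0 := by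
    intro h; apply hw; rw [hfP, h]; simp
  rw [hfP] at hz
  rcases mul_eq_zero.1 hz with h | h
  · rcases mul_eq_zero.1 h with h | h
    · rcases mul_eq_zero.1 h with h | h
      · exact absurd h hc
      · have h0 : z = 0 := by by_contra h1; exact pow_ne_zero _ h1 h
        simp [h0]
    · exact absurd h (Complex.exp_ne_zero _)
  · have := hP z
    rw [h] at this
    obtain ⟨k, rfl⟩ := exists_eq_of_hasProd_eq_zero hx hs this
    simp

/-- A finite product `∏ (1 - z / ξₖ)` with real `ξₖ ≠ 0` is in the Laguerre–Pólya class. -/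
theorem laguerrePolya_prod (n : ℕ) (ξ : Fin n → ℝ) (hξ : ∀ k, ξ k ≠ 0) :
    LaguerrePolya fun z => ∏ k, (1 - z / (ξ k : ℂ)) := by
  have : Finite {k : ℕ | k < n} := (Set.finite_lt_nat n)
  let _ := Fintype.ofFinite {k : ℕ | k < n}
  let e : {k : ℕ | k < n} ≃ Fin n := ⟨fun k => ⟨k.1, k.2⟩, fun k => ⟨k.1, k.2⟩, fun _ => rfl, fun _ => rfl⟩
  -- This `β` cancels the convergence factors `exp (z / ξ k)`.
  refine ⟨1, 0, -∑ k, (ξ k)⁻¹, 0, {k | k < n}, fun k => ξ (e k),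
    fun z => ∏ k, ((1 - z / (ξ k : ℂ)) * Complex.exp (z / (ξ k : ℂ))), le_rfl, fun k => hξ _,
    Summable.of_finite, fun z => ?_, fun z => ?_⟩
  · beta_reduce
    rw [← e.prod_comp]
    exact hasProd_fintype _
  · beta_reduce
    rw [Finset.prod_mul_distrib, ← Complex.exp_sum]
    have : ∑ k, z / (ξ k : ℂ) = (∑ k, ((ξ k : ℂ))⁻¹) * z := by
      rw [Finset.sum_mul]; refine Finset.sum_congr rfl fun k _ => by rw [div_eq_mul_inv, mul_comm]
    rw [this]
    push_cast
    rw [mul_comm (∏ k, (1 - z / (ξ k : ℂ))), ← mul_assoc, pow_zero, mul_one, one_mul,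
      ← Complex.exp_add]
    simp

/-! ### Alternating sums and sign changes. -/

/-- Partial sums of an alternating series with nonnegative decreasing terms. -/
theorem alternating_sum_mem_Icc (N : ℕ) (D : ℕ → ℝ) (h0 : ∀ i < N, 0 ≤ D i)
    (hD : ∀ i, i + 1 < N → D (i + 1) ≤ D i) :
    0 ≤ ∑ i ∈ Finset.range N, (-1) ^ i * D i ∧
      (0 < N → ∑ i ∈ Finset.range N, (-1) ^ i * D i ≤ D 0) := by
  induction N generalizing D with
  | zero => simp
  | succ N ih =>
    obtain ⟨h1, h2⟩ := ih (fun i => D (i + 1)) (fun i hi => h0 _ (by omega))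
      (fun i hi => hD _ (by omega))
    have hs : ∑ i ∈ Finset.range (N + 1), (-1) ^ i * D i =
        D 0 - ∑ i ∈ Finset.range N, (-1) ^ i * D (i + 1) := by
      rw [Finset.sum_range_succ', sub_eq_neg_add, ← Finset.sum_neg_distrib]
      congr 1
      · refine Finset.sum_congr rfl fun i _ => by ring
      · simp
    rw [hs]
    refine ⟨?_, fun _ => by linarith⟩
    rcases Nat.eq_zero_or_pos N with rfl | hN
    · simpa using h0 0 (by omega)
    · linarith [h2 hN, hD 0 (by omega)]

/-- An alternating sum read from its last term, which is the largest. -/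
theorem alternating_sum_reflect (s : ℕ) (T : ℕ → ℝ) :
    (-1) ^ (s + 1) * ∑ j ∈ Finset.range s, (-1) ^ j * T j =
      ∑ i ∈ Finset.range s, (-1) ^ i * T (s - 1 - i) := by
  rw [← Finset.sum_range_reflect, Finset.mul_sum]
  refine Finset.sum_congr rfl fun i hi => ?_
  have hi' := Finset.mem_range.1 hi
  rw [← mul_assoc, ← pow_add]
  congr 1
  rw [show s + 1 + (s - 1 - i) = 2 * (s - i) + i - 0 by omega, Nat.sub_zero, pow_add, pow_mul]
  simp

/-- A zero between two points at which a continuous function has opposite signs. -/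
theorem exists_zero_of_alternating {g : ℝ → ℝ} (hg : Continuous g) {x y : ℝ} {k : ℕ} (hxy : y ≤ x)
    (hx : 0 < (-1) ^ k * g x) (hy : 0 < (-1) ^ (k + 1) * g y) : ∃ ξ ∈ Set.Ioo y x, g ξ = 0 := by
  have hc : ContinuousOn (fun v => (-1) ^ k * g v) (Set.Icc y x) := by fun_prop
  obtain ⟨ξ, hξ, h⟩ := intermediate_value_Ioo hxy hc
    (show (0 : ℝ) ∈ _ from ⟨by rw [pow_succ] at hy; linarith, hx⟩)
  exact ⟨ξ, hξ, by simpa using h⟩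

/-! ### Partial theta sections and the threshold constant. -/

open Polynomial in
/-- The partial theta section as a real polynomial. -/
noncomputable def thetaPoly (a : ℝ) (n : ℕ) : ℝ[X] :=
  ∑ j ∈ Finset.range (n + 1), C (a ^ (j ^ 2))⁻¹ * X ^ j

theorem thetaPoly_coeff (a : ℝ) (n k : ℕ) :
    (thetaPoly a n).coeff k = if k < n + 1 then (a ^ (k ^ 2))⁻¹ else 0 := by
  simp [thetaPoly, Polynomial.coeff_C_mul, Polynomial.coeff_X_pow]

theorem thetaPoly_eval (a : ℝ) (n : ℕ) (x : ℝ) :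
    (thetaPoly a n).eval x = ∑ j ∈ Finset.range (n + 1), (a ^ (j ^ 2))⁻¹ * x ^ j := by
  simp [thetaPoly, Polynomial.eval_finsetSum]

theorem thetaPoly_eval_map (a : ℝ) (n : ℕ) (z : ℂ) :
    ((thetaPoly a n).map Complex.ofRealHom).eval z = partialThetaSection a n z := by
  simp [thetaPoly, Polynomial.eval_finsetSum, Polynomial.map_sum, partialThetaSection]

theorem thetaPoly_degree_lt (a : ℝ) (n : ℕ) : (thetaPoly a n).degree < (n + 1 : ℕ) := by
  rw [Polynomial.degree_lt_iff_coeff_zero]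
  intro k hk
  rw [thetaPoly_coeff, if_neg (by omega)]

/-- The partial theta section at `-a u`, as a function of `t = a²` and `u`. -/
noncomputable def thetaWindow (N : ℕ) (t u : ℝ) : ℝ :=
  ∑ i ∈ Finset.range (N + 1), (-1) ^ i * (u ^ i / t ^ (i.choose 2))

/-- At `z = -(u * a)` the summand `j` cancels against `a ^ j`, which leaves only powers of `t = a²`.
-/
theorem sq_eq_two_mul_choose_two_add (j : ℕ) : j ^ 2 = 2 * j.choose 2 + j := by
  induction j with
  | zero => rfl
  | succ j ih =>
    have : (j + 1).choose 2 = j + j.choose 2 := by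
      rw [Nat.choose_succ_succ' j 1, Nat.choose_one_right]
    rw [this]
    linarith

theorem thetaWindow_sq (N : ℕ) {a : ℝ} (ha : a ≠ 0) (u : ℝ) :
    thetaWindow N (a ^ 2) u = (thetaPoly a N).eval (-(u * a)) := by
  rw [thetaPoly_eval, thetaWindow]
  refine Finset.sum_congr rfl fun j _ => ?_
  rw [sq_eq_two_mul_choose_two_add, pow_add, pow_mul, neg_pow (u * a), mul_pow]
  field_simp

/-- A partial theta section in the Laguerre–Pólya class has a zero in `[-a³, -a]`, and
`a² ≥ 3`. -/
theorem LaguerrePolya.exists_thetaWindow_eq_zero {a : ℝ} (ha : 1 < a) {n : ℕ} (hn : 2 ≤ n)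
    (h : LaguerrePolya (partialThetaSection a n)) :
    3 ≤ a ^ 2 ∧ ∃ u, 1 ≤ u ∧ u ≤ a ^ 2 ∧ thetaWindow n (a ^ 2) u = 0 := by
  have ha0 : 0 < a := by linarith
  have hc0 : (thetaPoly a n).coeff 0 = 1 := by simp [thetaPoly_coeff]
  have hc1 : (thetaPoly a n).coeff 1 = a⁻¹ := by
    rw [thetaPoly_coeff, if_pos (by omega)]; simp
  have hc2 : (thetaPoly a n).coeff 2 = a⁻¹ ^ 4 := by
    rw [thetaPoly_coeff, if_pos (by omega)]; simp
  -- An inequality, so that `n = 2`, where this coefficient is `0`, is included.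
  have hc3 : (thetaPoly a n).coeff 3 ≤ a⁻¹ ^ 9 := by
    rw [thetaPoly_coeff]
    split_ifs
    · simp
    · positivity
  have hroots : ∀ z : ℂ, ((thetaPoly a n).map Complex.ofRealHom).eval z = 0 → z.im = 0 := by
    intro z hz
    rw [thetaPoly_eval_map] at hz
    refine h.im_eq_zero (w := 0) ?_ hz
    rw [← thetaPoly_eval_map, ← Polynomial.coeff_zero_eq_eval_zero, Polynomial.coeff_map, hc0]
    simp
  obtain ⟨s, hs0, hs⟩ := (thetaPoly a n).exists_eq_prod_one_add_C_mul_X hc0 hroots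
  have hzero : ∀ y ∈ s, (thetaPoly a n).eval (-y⁻¹) = 0 := by
    intro y hy
    rw [hs, Polynomial.eval_multiset_prod, Multiset.map_map]
    refine Multiset.prod_eq_zero (Multiset.mem_map.2 ⟨y, hy, ?_⟩)
    simp [hs0 y hy]
  have hpos : ∀ y ∈ s, 0 < y := by
    intro y hy
    by_contra hy'
    have h1 : 0 ≤ -y⁻¹ := by
      rw [Left.nonneg_neg_iff]; exact inv_nonpos.2 (not_lt.1 hy')
    have h2 := hzero y hy
    rw [thetaPoly_eval, Finset.sum_range_succ'] at h2
    have h3 : 0 ≤ ∑ k ∈ Finset.range n, (a ^ ((k + 1) ^ 2))⁻¹ * (-y⁻¹) ^ (k + 1) :=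
      Finset.sum_nonneg fun k _ => by positivity
    simp at h2
    linarith
  obtain ⟨-, e1, e2, e3⟩ := s.powerSums_of_prod_one_add_C_mul_X
  rw [← hs, hc1] at e1
  rw [← hs, hc1, hc2] at e2
  rw [← hs, hc1, hc2] at e3
  set b := a⁻¹ with hb
  have hb0 : 0 < b := by positivity
  have hb1 : b < 1 := inv_lt_one_of_one_lt₀ ha
  have hbsq : b ^ 2 < 1 := by nlinarith
  have hb3 : b ^ 2 ≤ 1 / 3 := by
    -- Here `l` is the second power sum divided by the first. This choice minimises `∑ y (y - l)²`,
    -- whose nonnegativity is then the Cauchy–Schwarz inequality between the first three power sums.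
    set l := b * (1 - 2 * b ^ 2) with hl
    have hq : 0 ≤ (s.map fun y => y * (y - l) ^ 2).sum := by
      refine Multiset.sum_nonneg fun v hv => ?_
      obtain ⟨y, hy, rfl⟩ := Multiset.mem_map.1 hv
      have := hpos y hy
      positivity
    have hexp : (s.map fun y => y * (y - l) ^ 2).sum =
        (s.map fun y => y ^ 3).sum - 2 * l * (s.map fun y => y ^ 2).sum + l ^ 2 * s.sum := by
      have : (fun y : ℝ => y * (y - l) ^ 2) =
          fun y => y ^ 3 + (-2 * l) * y ^ 2 + l ^ 2 * y := by funext y; ring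
      rw [this, Multiset.sum_map_add, Multiset.sum_map_add, Multiset.sum_map_mul_left,
        Multiset.sum_map_mul_left, Multiset.map_id']
      ring
    rw [hexp, e1, e2, e3] at hq
    have h1 : 0 ≤ b ^ 5 * ((3 * b ^ 2 - 1) * (b ^ 2 - 1)) := by
      have : b ^ 3 - 3 * b * b ^ 4 + 3 * b ^ 9 - 2 * l * (b ^ 2 - 2 * b ^ 4) + l ^ 2 * b =
          b ^ 5 * ((3 * b ^ 2 - 1) * (b ^ 2 - 1)) := by rw [hl]; ring
      linarith
    have h2 := nonneg_of_mul_nonneg_right h1 (by positivity)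
    nlinarith
  have hab : a * b = 1 := mul_inv_cancel₀ ha0.ne'
  refine ⟨?_, ?_⟩
  · have : a ^ 2 * b ^ 2 = 1 := by rw [← mul_pow, hab, one_pow]
    nlinarith [sq_nonneg a]
  · have hex : ∃ y ∈ s, b ^ 3 ≤ y := by
      by_contra! hlt
      have hne : s ≠ 0 := by
        rintro rfl
        simp at e1
        exact hb0.ne e1
      have := Multiset.sum_lt_sum_of_nonempty (f := fun y => y ^ 2) (g := fun y => b ^ 3 * y) hne
        (fun y hy => by nlinarith [hpos y hy, hlt y hy])
      rw [Multiset.sum_map_mul_left, Multiset.map_id', e1, e2] at this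
      have : b ^ 2 < 3 * b ^ 2 * b ^ 2 := by linarith
      nlinarith [sq_nonneg b]
    obtain ⟨y, hy, hby⟩ := hex
    have hy0 := hpos y hy
    have hyb : y ≤ b := by
      rw [← e1]
      exact Multiset.single_le_sum (fun v hv => (hpos v hv).le) y hy
    refine ⟨b * y⁻¹, ?_, ?_, ?_⟩
    · rw [← div_eq_mul_inv]; exact (one_le_div hy0).2 hyb
    · rw [← div_eq_mul_inv, div_le_iff₀ hy0]
      calc b = a ^ 2 * b ^ 3 := by
            calc b = (a * b) ^ 2 * b := by rw [hab]; ring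
              _ = _ := by ring
        _ ≤ _ := by gcongr
    · rw [thetaWindow_sq n ha0.ne', show b * y⁻¹ * a = y⁻¹ by
        rw [mul_right_comm, mul_comm b a, hab, one_mul]]
      exact hzero y hy

/-- At `-a^{2k}` the `k`-th term of a partial theta section dominates. -/
theorem thetaPoly_eval_sign {a : ℝ} (ha : 2 < a) {n k : ℕ} (hk : k ≤ n) :
    0 < (-1) ^ k * (thetaPoly a n).eval (-a ^ (2 * k)) := by
  have ha0 : 0 < a := by linarith
  have ha1 : 1 < a := by linarith
  set T : ℕ → ℝ := fun j => (a ^ (j ^ 2))⁻¹ * (a ^ (2 * k)) ^ j with hT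
  have hT0 : ∀ j, 0 < T j := fun j => by positivity
  -- The ratio of consecutive terms is `a ^ (2k - 2j - 1)`, so moduli drop by a factor of at least
  -- `a` at each step away from index `k`. Each side is then at most `T k / a` in alternating sum,
  -- and `2 / a < 1`.
  have hstep : ∀ j, T (j + 1) * a ^ (2 * j + 1) = T j * a ^ (2 * k) := by
    intro j
    simp only [hT]
    rw [show (j + 1) ^ 2 = j ^ 2 + (2 * j + 1) by ring, pow_add a (j ^ 2), pow_succ _ j]
    field_simp
  have hup : ∀ j, j + 1 ≤ k → a * T j ≤ T (j + 1) := by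
    intro j hj
    have h1 : a ^ (2 * k) = a ^ (2 * j + 1) * a * a ^ (2 * (k - j - 1)) := by
      rw [← pow_succ, ← pow_add]; congr 1; omega
    have h2 : T (j + 1) = T j * a * a ^ (2 * (k - j - 1)) := by
      have := hstep j
      rw [h1] at this
      have h3 : a ^ (2 * j + 1) ≠ 0 := by positivity
      apply mul_right_cancel₀ h3
      rw [this]; ring
    rw [h2, mul_comm a]
    exact le_mul_of_one_le_right (by have := hT0 j; positivity) (one_le_pow₀ ha1.le)
  have hdown : ∀ j, k ≤ j → a * T (j + 1) ≤ T j := by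
    intro j hj
    have h1 : a ^ (2 * j + 1) = a ^ (2 * k) * a * a ^ (2 * (j - k)) := by
      rw [← pow_succ, ← pow_add]; congr 1; omega
    have h2 : T j = T (j + 1) * a * a ^ (2 * (j - k)) := by
      have := hstep j
      rw [h1] at this
      have h3 : a ^ (2 * k) ≠ 0 := by positivity
      apply mul_right_cancel₀ h3
      rw [← this]; ring
    rw [h2, mul_comm a]
    exact le_mul_of_one_le_right (by have := hT0 (j + 1); positivity) (one_le_pow₀ ha1.le)
  have hle : ∀ x y : ℝ, 0 < x → a * x ≤ y → x ≤ y := fun x y hx h => by nlinarith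
  have heval : (thetaPoly a n).eval (-a ^ (2 * k)) = ∑ j ∈ Finset.range (n + 1), (-1) ^ j * T j := by
    rw [thetaPoly_eval]
    refine Finset.sum_congr rfl fun j _ => ?_
    rw [neg_pow, hT]; ring
  have hsplit : ∑ j ∈ Finset.range (n + 1), (-1) ^ j * T j =
      ∑ j ∈ Finset.range k, (-1) ^ j * T j + (-1) ^ k * T k +
        ∑ i ∈ Finset.range (n - k), (-1) ^ (k + 1 + i) * T (k + 1 + i) := by
    rw [← Finset.sum_range_succ, ← Finset.sum_range_add]
    congr 2; omega
  have hleft := alternating_sum_reflect k T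
  have hright : (-1) ^ k * ∑ i ∈ Finset.range (n - k), (-1) ^ (k + 1 + i) * T (k + 1 + i) =
      -∑ i ∈ Finset.range (n - k), (-1) ^ i * T (k + 1 + i) := by
    rw [Finset.mul_sum, ← Finset.sum_neg_distrib]
    refine Finset.sum_congr rfl fun i _ => ?_
    rw [← mul_assoc, ← pow_add, show k + (k + 1 + i) = 2 * k + (i + 1) by ring, pow_add, pow_mul]
    simp [pow_succ]
  have hL := (alternating_sum_mem_Icc k (fun i => T (k - 1 - i)) (fun i _ => (hT0 _).le)
    (fun i hi => by
      have := hup (k - 1 - (i + 1)) (by omega)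
      rw [show k - 1 - (i + 1) + 1 = k - 1 - i by omega] at this
      exact hle _ _ (hT0 _) this)).2
  have hR := (alternating_sum_mem_Icc (n - k) (fun i => T (k + 1 + i)) (fun i _ => (hT0 _).le)
    (fun i _ => hle _ _ (hT0 _) (hdown (k + 1 + i) (by omega)))).2
  have hLk : ∑ i ∈ Finset.range k, (-1) ^ i * T (k - 1 - i) ≤ T k / a := by
    rcases Nat.eq_zero_or_pos k with h0 | h0
    · subst h0; simpa using div_nonneg (hT0 0).le ha0.le
    · refine (hL h0).trans ?_
      rw [le_div_iff₀ ha0, mul_comm]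
      have := hup (k - 1) (by omega)
      rwa [show k - 1 + 1 = k by omega] at this
  have hRk : ∑ i ∈ Finset.range (n - k), (-1) ^ i * T (k + 1 + i) ≤ T k / a := by
    rcases Nat.eq_zero_or_pos (n - k) with h0 | h0
    · rw [h0]; simpa using div_nonneg (hT0 k).le ha0.le
    · refine (hR h0).trans ?_
      rw [le_div_iff₀ ha0, mul_comm]
      exact hdown k le_rfl
  have hTk : 2 * (T k / a) < T k := by
    rw [← mul_div_assoc, div_lt_iff₀ ha0]; nlinarith [hT0 k]
  rw [heval, hsplit, mul_add, mul_add, hright, ← mul_assoc, ← pow_add, Even.neg_one_pow ⟨k, rfl⟩]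
  rw [pow_succ] at hleft
  linarith

/-- For `a > 2` every partial theta section is in the Laguerre–Pólya class. -/
theorem laguerrePolya_partialThetaSection {a : ℝ} (ha : 2 < a) (n : ℕ) :
    LaguerrePolya (partialThetaSection a n) := by
  have ha1 : 1 < a := by linarith
  have hex : ∀ k : Fin n, ∃ ξ ∈ Set.Ioo (-a ^ (2 * (k.1 + 1))) (-a ^ (2 * k.1)),
      (thetaPoly a n).eval ξ = 0 := fun k =>
    exists_zero_of_alternating (thetaPoly a n).continuous
      (neg_le_neg (pow_le_pow_right₀ ha1.le (by omega)))
      (thetaPoly_eval_sign ha (by omega)) (thetaPoly_eval_sign ha (by omega))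
  choose ξ hξ hξ0 using hex
  have hneg : ∀ k, ξ k < 0 := fun k =>
    (hξ k).2.trans (neg_lt_zero.2 (by positivity))
  have hinj : StrictAnti ξ := by
    intro i j hij
    refine (hξ j).2.trans_le (le_trans (neg_le_neg ?_) (hξ i).1.le)
    exact pow_le_pow_right₀ ha1.le (by have : i.1 < j.1 := hij; omega)
  have hpoly : thetaPoly a n =
      ∏ k, (1 - Polynomial.C (ξ k)⁻¹ * Polynomial.X) := by
    -- Both sides have degree at most `n` and agree at `n + 1` points: the `n` zeros and `0`.
    refine Polynomial.eq_of_degrees_lt_of_eval_index_eq (v := (Fin.cons 0 ξ : Fin (n + 1) → ℝ))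
      Finset.univ ?_ ?_ ?_ ?_
    · refine Set.injOn_of_injective (Fin.cons_injective_iff.2 ⟨?_, hinj.injective⟩)
      rintro ⟨k, hk⟩
      exact (hneg k).ne hk
    · simpa using thetaPoly_degree_lt a n
    · rw [Finset.card_univ, Fintype.card_fin]
      refine (Polynomial.degree_prod_le _ _).trans_lt ?_
      refine lt_of_le_of_lt (Finset.sum_le_card_nsmul _ _ 1 fun k _ => ?_) ?_
      · refine (Polynomial.degree_sub_le _ _).trans (max_le (by simp) ?_)
        exact Polynomial.degree_C_mul_X_le _
      · simp only [Finset.card_univ, Fintype.card_fin, nsmul_eq_mul, mul_one]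
        exact_mod_cast Nat.lt_succ_self n
    · intro i _
      rw [Polynomial.eval_prod]
      refine Fin.cases ?_ (fun k => ?_) i
      · rw [Fin.cons_zero, ← Polynomial.coeff_zero_eq_eval_zero, thetaPoly_coeff]
        simp
      · rw [Fin.cons_succ, hξ0 k]
        refine (Finset.prod_eq_zero (Finset.mem_univ k) ?_).symm
        simp [(hneg k).ne]
  have : partialThetaSection a n = fun z => ∏ k, (1 - z / (ξ k : ℂ)) := by
    funext z
    rw [← thetaPoly_eval_map, hpoly, Polynomial.map_prod, Polynomial.eval_prod]
    refine Finset.prod_congr rfl fun k _ => ?_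
    simp only [Polynomial.map_sub, Polynomial.map_one, Polynomial.map_mul, Polynomial.map_C,
      Polynomial.map_X, Polynomial.eval_sub, Polynomial.eval_one, Polynomial.eval_mul,
      Polynomial.eval_C, Polynomial.eval_X, Complex.ofRealHom_eq_coe, Complex.ofReal_inv]
    rw [div_eq_mul_inv, mul_comm]
  rw [this]
  exact laguerrePolya_prod n ξ fun k => (hneg k).ne

/-- At the threshold constant the theta window still takes a nonpositive value. -/
theorem exists_thetaWindow_nonpos {n : ℕ} (hn : 2 ≤ n) :
    3 ≤ thetaConst n ∧ ∃ u, 1 ≤ u ∧ u ≤ thetaConst n ∧ thetaWindow n (thetaConst n) u ≤ 0 := by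
  set B : Set ℝ := {t : ℝ | ∃ a : ℝ, 1 < a ∧ t = a ^ 2 ∧ LaguerrePolya (partialThetaSection a n)}
    with hB
  have hc : thetaConst n = sInf B := rfl
  have hne : B.Nonempty := ⟨_, 3, by norm_num, rfl, laguerrePolya_partialThetaSection (by norm_num) n⟩
  have hbdd : BddBelow B := ⟨0, by rintro t ⟨a, -, rfl, -⟩; positivity⟩
  obtain ⟨v, -, hv, hvB⟩ := exists_seq_tendsto_sInf hne hbdd
  set M := sInf B + 1 with hM
  -- The conditions on `(t, u)` are closed and bounded, so they survive passage to the infimum of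
  -- `B`; the infimum need not be known to be attained.
  set A : Set (ℝ × ℝ) := (Set.Icc 3 M ×ˢ Set.Icc 1 M) ∩ {p | p.2 ≤ p.1 ∧ thetaWindow n p.1 p.2 ≤ 0}
    with hA
  have hA' : IsCompact A := by
    have hcont : ContinuousOn (fun p : ℝ × ℝ => thetaWindow n p.1 p.2)
        (Set.Icc 3 M ×ˢ Set.Icc 1 M) := by
      unfold thetaWindow
      refine continuousOn_finsetSum _ fun i _ => ?_
      refine continuousOn_const.mul (ContinuousOn.div (by fun_prop) (by fun_prop) ?_)
      intro p hp
      have : (3 : ℝ) ≤ p.1 := hp.1.1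
      have : p.1 ≠ 0 := by linarith
      exact pow_ne_zero _ this
    have hK : IsCompact (Set.Icc 3 M ×ˢ Set.Icc 1 M) := isCompact_Icc.prod isCompact_Icc
    have h1 : IsClosed ((Set.Icc 3 M ×ˢ Set.Icc 1 M) ∩
        (fun p : ℝ × ℝ => thetaWindow n p.1 p.2) ⁻¹' Set.Iic 0) :=
      hcont.preimage_isClosed_of_isClosed hK.isClosed isClosed_Iic
    have h2 : IsClosed {p : ℝ × ℝ | p.2 ≤ p.1} := isClosed_le continuous_snd continuous_fst
    refine (hK.inter_right (h2.inter h1)).of_isClosed_subset ?_ ?_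
    · convert h2.inter h1 using 1
      ext p; simp only [hA, Set.mem_inter_iff, Set.mem_ofPred_eq, Set.mem_preimage, Set.mem_Iic]
      tauto
    · rintro p ⟨h, h', h''⟩
      exact ⟨h, h', h, h''⟩
  have hmem : sInf B ∈ Prod.fst '' A := by
    refine (hA'.image continuous_fst).isClosed.mem_of_tendsto hv ?_
    filter_upwards [hv.eventually (gt_mem_nhds (show sInf B < M by linarith))] with k hk
    obtain ⟨a, ha, hva, hLP⟩ := hvB k
    obtain ⟨h3, u, hu1, hu2, hu⟩ := hLP.exists_thetaWindow_eq_zero ha hn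
    rw [← hva] at h3 hu2 hu
    exact ⟨(v k, u), ⟨⟨⟨h3, hk.le⟩, hu1, hu2.trans hk.le⟩, hu2, hu.le⟩, rfl⟩
  obtain ⟨⟨t, u⟩, ⟨⟨⟨h3, -⟩, h1, -⟩, hut, hW⟩, rfl⟩ := hmem
  rw [hc]
  simp only at *
  exact ⟨h3, u, h1, hut, hW⟩

/-! ### Damping a theta window. -/

/-- Comparison of the theta window with a window whose terms are damped by the factors
`∏_{j < i} X j`. -/
theorem alternating_sum_le_thetaWindow {m : ℕ} (hm : 1 ≤ m) {t u : ℝ} (ht : 3 ≤ t) (hu1 : 1 ≤ u)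
    (hut : u ≤ t) (X : ℕ → ℝ) (hX0 : X 0 = 1) (hXpos : ∀ i < 2 * m, 0 < X i)
    (hX1 : ∀ i < 2 * m, X i ≤ 1) (hX2 : ∀ i, 1 ≤ i → i + 1 < 2 * m → X i ^ 2 ≤ X (i + 1)) :
    ∑ i ∈ Finset.range (2 * m + 1), (-1) ^ i * (u ^ i / t ^ (i.choose 2) * ∏ j ∈ Finset.range i, X j)
      ≤ thetaWindow (2 * m) t u := by
  have ht0 : 0 < t := by linarith
  have hu0 : 0 < u := by linarith
  set L : ℕ → ℝ := fun i => ∏ j ∈ Finset.range i, X j with hL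
  set τ : ℕ → ℝ := fun i => u ^ i / t ^ (i.choose 2) with hτ
  have hL0 : ∀ i ≤ 2 * m, 0 < L i := fun i hi =>
    Finset.prod_pos fun j hj => hXpos j (by have := Finset.mem_range.1 hj; omega)
  have hL1 : ∀ i ≤ 2 * m, L i ≤ 1 := fun i hi =>
    Finset.prod_le_one (fun j hj => (hXpos j (by have := Finset.mem_range.1 hj; omega)).le)
      fun j hj => hX1 j (by have := Finset.mem_range.1 hj; omega)
  have hLs : ∀ i, L (i + 1) = L i * X i := fun i => Finset.prod_range_succ _ _
  have hτ0 : ∀ i, 0 < τ i := fun i => by positivity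
  have hτs : ∀ i, τ (i + 1) = τ i * (u / t ^ i) := by
    intro i
    simp only [hτ]
    rw [Nat.choose_succ_succ' i 1, Nat.choose_one_right, pow_succ, pow_add]
    field_simp
  set D : ℕ → ℝ := fun i => τ i * (1 - L i) with hD
  have hDpos : ∀ i ≤ 2 * m, 0 ≤ D i := fun i hi =>
    mul_nonneg (hτ0 i).le (by linarith [hL1 i hi])
  have hDanti : ∀ i, 2 ≤ i → i + 1 ≤ 2 * m → D (i + 1) ≤ D i := by
    intro i hi hi'
    obtain ⟨j, rfl⟩ := Nat.exists_eq_add_of_le' hi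
    have h1 : τ (j + 2 + 1) ≤ τ (j + 2) * (1 / 3) := by
      rw [hτs]
      refine mul_le_mul_of_nonneg_left ?_ (hτ0 _).le
      rw [div_le_div_iff₀ (by positivity) (by norm_num), one_mul]
      calc u * 3 ≤ t * t := by gcongr
        _ = t ^ 2 := by ring
        _ ≤ t ^ (j + 2) := pow_le_pow_right₀ (by linarith) (by omega)
    -- With `L = L (j + 2) ≤ X (j + 1)`, the condition on squares gives `L (j + 3) ≥ L³`, and `1 -
    -- L³ ≤ 3 (1 - L)`. The factor `3` is exactly what `t ≥ 3` compensates in `h1`.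
    have h2 : 1 - L (j + 2 + 1) ≤ 3 * (1 - L (j + 2)) := by
      have ha : L (j + 2) ≤ X (j + 1) := by
        rw [hLs (j + 1)]
        exact mul_le_of_le_one_left (hXpos _ (by omega)).le (hL1 _ (by omega))
      have hb := hX2 (j + 1) (by omega) (by omega)
      have hc := hL0 (j + 2) (by omega)
      have hd := hL1 (j + 2) (by omega)
      have he := hX1 (j + 2) (by omega)
      rw [hLs (j + 2)]
      have hf : L (j + 2) ^ 2 ≤ X (j + 1 + 1) := le_trans (by gcongr) hb
      have hf' : L (j + 2) ^ 2 ≤ X (j + 2) := hf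
      nlinarith
    have h3 : 0 ≤ 1 - L (j + 2 + 1) := by linarith [hL1 (j + 2 + 1) (by omega)]
    calc D (j + 2 + 1) ≤ τ (j + 2) * (1 / 3) * (3 * (1 - L (j + 2))) :=
          mul_le_mul h1 h2 h3 (by have := hτ0 (j + 2); positivity)
      _ = D (j + 2) := by simp only [hD]; ring
  have hD0 : D 0 = 0 := by simp [hD, hL]
  have hD1 : D 1 = 0 := by simp [hD, hL, hX0]
  have hsum : 0 ≤ ∑ i ∈ Finset.range (2 * m + 1), (-1) ^ i * D i := by
    -- The terms `0` and `1` vanish, so the alternating sum effectively starts at index `2`, with a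
    -- plus sign.
    obtain ⟨l, hl⟩ : ∃ l, 2 * m + 1 = l + 1 + 1 := ⟨2 * m - 1, by omega⟩
    rw [hl, Finset.sum_range_succ', Finset.sum_range_succ']
    simp only [zero_add, hD0, hD1, mul_zero, add_zero]
    have := (alternating_sum_mem_Icc l (fun i => D (i + 1 + 1)) (fun i hi => hDpos _ (by omega))
      (fun i hi => hDanti (i + 1 + 1) (by omega) (by omega))).1
    refine this.trans_eq (Finset.sum_congr rfl fun i _ => by ring)
  have : thetaWindow (2 * m) t u - ∑ i ∈ Finset.range (2 * m + 1), (-1) ^ i * (τ i * L i) =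
      ∑ i ∈ Finset.range (2 * m + 1), (-1) ^ i * D i := by
    rw [thetaWindow, ← Finset.sum_sub_distrib]
    refine Finset.sum_congr rfl fun i _ => by simp only [hD, hτ]; ring
  linarith

/-! ### Coefficient ratios and the sign of the series. -/

/-- The ratio `a_{k-1} / a_k` of consecutive coefficients. -/
noncomputable def coeffRatio (a : ℕ → ℝ) (k : ℕ) : ℝ := a (k - 1) / a k

section CoeffRatio

variable {a : ℕ → ℝ}

theorem coeffRatio_pos (ha : ∀ k, 0 < a k) (k : ℕ) : 0 < coeffRatio a k := div_pos (ha _) (ha _)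

theorem mul_coeffRatio_succ (ha : ∀ k, 0 < a k) (k : ℕ) :
    a (k + 1) * coeffRatio a (k + 1) = a k := by
  rw [coeffRatio, Nat.add_sub_cancel, mul_div_cancel₀ _ (ha _).ne']

/-- The case `k = 0` is excluded because truncated subtraction makes `coeffRatio a 0` equal to `1`.
-/
theorem coeffRatio_succ (ha : ∀ k, 0 < a k) {k : ℕ} (hk : 1 ≤ k) :
    coeffRatio a (k + 1) = secondQuotient a (k + 1) * coeffRatio a k := by
  obtain ⟨j, rfl⟩ := Nat.exists_eq_add_of_le' hk
  have h0 := (ha j).ne'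
  have h1 := (ha (j + 1)).ne'
  have h2 := (ha (j + 1 + 1)).ne'
  simp only [coeffRatio, secondQuotient, Nat.add_sub_cancel, show j + 1 + 1 - 2 = j by omega]
  field_simp

theorem secondQuotient_le (hmono : ∀ n : ℕ, 2 ≤ n → secondQuotient a n ≤ secondQuotient a (n + 1))
    {i j : ℕ} (hi : 2 ≤ i) (hij : i ≤ j) : secondQuotient a i ≤ secondQuotient a j := by
  induction j, hij using Nat.le_induction with
  | base => exact le_rfl
  | succ j hj ih => exact ih.trans (hmono j (by omega))

theorem two_mul_coeffRatio_le (ha : ∀ k, 0 < a k) (hq2 : 2 ≤ secondQuotient a 2)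
    (hmono : ∀ n : ℕ, 2 ≤ n → secondQuotient a n ≤ secondQuotient a (n + 1)) {k : ℕ} (hk : 1 ≤ k) :
    2 * coeffRatio a k ≤ coeffRatio a (k + 1) := by
  rw [coeffRatio_succ ha hk]
  have := hq2.trans (secondQuotient_le hmono le_rfl (show 2 ≤ k + 1 by omega))
  exact mul_le_mul_of_nonneg_right this (coeffRatio_pos ha k).le

theorem coeffRatio_le (ha : ∀ k, 0 < a k) (hq2 : 2 ≤ secondQuotient a 2)
    (hmono : ∀ n : ℕ, 2 ≤ n → secondQuotient a n ≤ secondQuotient a (n + 1)) {i j : ℕ} (hi : 1 ≤ i)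
    (hij : i ≤ j) : coeffRatio a i ≤ coeffRatio a j := by
  induction j, hij using Nat.le_induction with
  | base => exact le_rfl
  | succ j hj ih =>
    have h1 := two_mul_coeffRatio_le ha hq2 hmono (show 1 ≤ j by omega)
    have h2 := coeffRatio_pos ha j
    linarith

/-- The sign of a power series with increasing second quotients near the point where its terms of
index `n - 1` and `n` balance. -/
theorem exists_sign_pos (ha : ∀ k, 0 < a k) {g : ℝ → ℝ}
    (hg : ∀ x, HasSum (fun k => a k * x ^ k) (g x)) (hq2 : 2 ≤ secondQuotient a 2)
    (hmono : ∀ n : ℕ, 2 ≤ n → secondQuotient a n ≤ secondQuotient a (n + 1))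
    {m s : ℕ} (hm : 1 ≤ m) {t u : ℝ} (ht : 3 ≤ t) (hu1 : 1 ≤ u) (hut : u ≤ t)
    (hW : thetaWindow (2 * m) t u ≤ 0) (hts : t ≤ secondQuotient a (s + 2)) :
    ∃ y, coeffRatio a (s + 2 * m - 1) ≤ y ∧ y ≤ coeffRatio a (s + 2 * m) ∧
      0 < (-1) ^ (s + 2 * m - 1) * g (-y) := by
  have ht0 : 0 < t := by linarith
  have hu0 : 0 < u := by linarith
  set p := coeffRatio a with hp
  set q := secondQuotient a with hq
  set n := s + 2 * m with hn
  have hp0 : ∀ k, 0 < p k := coeffRatio_pos ha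
  have hps : ∀ k, 1 ≤ k → p (k + 1) = q (k + 1) * p k := fun k hk => coeffRatio_succ ha hk
  have hple : ∀ i j, 1 ≤ i → i ≤ j → p i ≤ p j := fun i j => coeffRatio_le ha hq2 hmono
  have htq : ∀ i, s + 2 ≤ i → t ≤ q i := fun i hi =>
    hts.trans (secondQuotient_le hmono (by omega) hi)
  -- Chosen so that the terms of index `n - 1` and `n` have ratio exactly `u`, as in the theta
  -- window.
  set y := p n / u with hy
  have hy0 : 0 < y := div_pos (hp0 n) hu0
  have hyn : y ≤ p n := div_le_self (hp0 n).le hu1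
  have hny : p (n - 1) ≤ y := by
    rw [hy, le_div_iff₀ hu0]
    have h1 := hps (n - 1) (by omega)
    rw [show n - 1 + 1 = n by omega] at h1
    rw [h1, mul_comm]
    exact mul_le_mul_of_nonneg_right (hut.trans (htq n (by omega))) (hp0 _).le
  refine ⟨y, hny, hyn, ?_⟩
  set T : ℕ → ℝ := fun j => a j * y ^ j with hT
  have hT0 : ∀ j, 0 < T j := fun j => mul_pos (ha j) (pow_pos hy0 j)
  have hstep : ∀ j, T (j + 1) * p (j + 1) = T j * y := by
    intro j
    have := mul_coeffRatio_succ ha j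
    simp only [hT]
    rw [← this, pow_succ]; ring
  have hup : ∀ j, j + 1 ≤ n - 1 → T j ≤ T (j + 1) := by
    intro j hj
    have h1 : p (j + 1) ≤ y := (hple _ _ (by omega) hj).trans hny
    by_contra! h
    have := mul_lt_mul h h1 (hp0 _) (hT0 j).le
    rw [hstep] at this
    exact lt_irrefl _ this
  have hdown : ∀ j, n ≤ j → T (j + 1) ≤ T j := by
    intro j hj
    have h1 : y ≤ p (j + 1) := hyn.trans (hple _ _ (by omega) (by omega))
    by_contra! h
    have := mul_lt_mul h h1 hy0 (hT0 _).le
    rw [hstep] at this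
    exact lt_irrefl _ this
  have hdown' : T (n + 1 + 1) < T (n + 1) := by
    have h2 : p (n + 1) < p (n + 1 + 1) := by
      have := two_mul_coeffRatio_le ha hq2 hmono (show 1 ≤ n + 1 by omega)
      have := hp0 (n + 1)
      simp only [hp] at *
      linarith
    have h1 : y < p (n + 1 + 1) := (hyn.trans (hple _ _ (by omega) (by omega))).trans_lt h2
    by_contra! h
    have := mul_lt_mul' h h1 hy0.le (hT0 _)
    rw [hstep] at this
    exact lt_irrefl _ this
  -- If all second quotients in the block were equal to `t`, each of these factors would be `1`;
  -- they measure the damping.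
  set X : ℕ → ℝ := fun i => t ^ i * p (n - i) / p n with hX
  have hX0 : X 0 = 1 := by simp [hX, (hp0 n).ne']
  have hXpos : ∀ i, 0 < X i := fun i => by have := hp0 (n - i); have := hp0 n; positivity
  have hXs : ∀ i, i + 1 < 2 * m → X (i + 1) = X i * (t / q (n - i)) := by
    intro i hi
    have h1 := hps (n - (i + 1)) (by omega)
    rw [show n - (i + 1) + 1 = n - i by omega] at h1
    have h2 : 0 < q (n - i) := ht0.trans_le (htq _ (by omega))
    simp only [hX]
    rw [h1, pow_succ]
    field_simp
  have hρ1 : ∀ i, i + 1 < 2 * m → t / q (n - i) ≤ 1 := fun i hi =>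
    (div_le_one (ht0.trans_le (htq _ (by omega)))).2 (htq _ (by omega))
  have hX1 : ∀ i < 2 * m, X i ≤ 1 := by
    intro i
    induction i with
    | zero => intro _; exact hX0.le
    | succ i ih =>
      intro hi
      rw [hXs i hi]
      exact mul_le_one₀ (ih (by omega))
        (div_pos ht0 (ht0.trans_le (htq _ (by omega)))).le (hρ1 i hi)
  -- `X i` is a product of factors `t / q ≤ 1`. It is at most its last factor, which is at most the
  -- next one because `q` decreases along descending indices.
  have hX2 : ∀ i, 1 ≤ i → i + 1 < 2 * m → X i ^ 2 ≤ X (i + 1) := by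
    intro i hi hi'
    obtain ⟨j, rfl⟩ := Nat.exists_eq_add_of_le' hi
    rw [hXs _ hi', sq]
    refine mul_le_mul_of_nonneg_left ?_ (hXpos _).le
    have h1 : 0 < q (n - (j + 1)) := ht0.trans_le (htq _ (by omega))
    have h2 : 0 < q (n - j) := ht0.trans_le (htq _ (by omega))
    rw [hXs j (by omega)]
    calc X j * (t / q (n - j)) ≤ t / q (n - j) :=
          mul_le_of_le_one_left (div_pos ht0 h2).le (hX1 j (by omega))
      _ ≤ _ := div_le_div_of_nonneg_left ht0.le h1
          (secondQuotient_le hmono (by omega) (by omega))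
  have hTX : ∀ i ≤ 2 * m, T (n - i) =
      T n * (u ^ i / t ^ (i.choose 2) * ∏ j ∈ Finset.range i, X j) := by
    intro i
    induction i with
    | zero => simp
    | succ i ih =>
      intro hi
      have h1 := hstep (n - (i + 1))
      rw [show n - (i + 1) + 1 = n - i by omega] at h1
      have h2 : T (n - (i + 1)) = T (n - i) * (p (n - i) / y) := by
        field_simp
        linarith
      have h3 : p (n - i) / y = u / t ^ i * X i := by
        have := (hp0 n).ne'
        simp only [hX, hy]
        field_simp
      rw [h2, ih (by omega), h3, Finset.prod_range_succ, Nat.choose_succ_succ' i 1,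
        Nat.choose_one_right, pow_add t, pow_succ u]
      field_simp
  have hwin : ∑ i ∈ Finset.range (2 * m + 1), (-1) ^ i * T (n - i) ≤ 0 := by
    have h1 := (alternating_sum_le_thetaWindow hm ht hu1 hut X hX0 (fun i _ => hXpos i) hX1
      hX2).trans hW
    have h2 : ∑ i ∈ Finset.range (2 * m + 1), (-1) ^ i * T (n - i) =
        T n * ∑ i ∈ Finset.range (2 * m + 1),
          (-1) ^ i * (u ^ i / t ^ (i.choose 2) * ∏ j ∈ Finset.range i, X j) := by
      rw [Finset.mul_sum]
      refine Finset.sum_congr rfl fun i hi => ?_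
      rw [hTX i (by have := Finset.mem_range.1 hi; omega)]; ring
    rw [h2]
    exact mul_nonpos_of_nonneg_of_nonpos (hT0 n).le h1
  -- The lower tail and the block contribute at least `0`. The lower bound from the upper tail is
  -- positive and independent of `N`, so strictness survives the limit.
  have hpart : ∀ N, T (n + 1) - T (n + 1 + 1) ≤
      (-1) ^ (n - 1) * ∑ j ∈ Finset.range (n + 1 + (N + 1)), (-1) ^ j * T j := by
    intro N
    have hs1 : ∑ j ∈ Finset.range (n + 1 + (N + 1)), (-1) ^ j * T j =
        ∑ j ∈ Finset.range s, (-1) ^ j * T j +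
        ∑ i ∈ Finset.range (2 * m + 1), (-1) ^ (s + i) * T (s + i) +
        ∑ i ∈ Finset.range (N + 1), (-1) ^ (n + 1 + i) * T (n + 1 + i) := by
      rw [← Finset.sum_range_add, show s + (2 * m + 1) = n + 1 from rfl, ← Finset.sum_range_add]
    have e0 : (-1 : ℝ) ^ (n - 1) = (-1) ^ (s + 1) := by
      rw [show n - 1 = s + 1 + 2 * (m - 1) by omega, pow_add, pow_mul]; simp
    have h1 := (alternating_sum_mem_Icc s (fun i => T (s - 1 - i)) (fun i _ => (hT0 _).le)
      (fun i hi => by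
        have := hup (s - 1 - (i + 1)) (by omega)
        rwa [show s - 1 - (i + 1) + 1 = s - 1 - i by omega] at this)).1
    rw [← alternating_sum_reflect, ← e0] at h1
    have h2 : (-1) ^ (n - 1) * ∑ i ∈ Finset.range (2 * m + 1), (-1) ^ (s + i) * T (s + i) =
        -∑ i ∈ Finset.range (2 * m + 1), (-1) ^ i * T (n - i) := by
      rw [← Finset.sum_range_reflect (fun i => (-1 : ℝ) ^ i * T (n - i)), Finset.mul_sum,
        ← Finset.sum_neg_distrib]
      refine Finset.sum_congr rfl fun i hi => ?_
      have hi' := Finset.mem_range.1 hi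
      have hpar : (-1 : ℝ) ^ (n - 1 + (s + i) + 1) = (-1) ^ (2 * m + 1 - 1 - i) := by
        rw [show n - 1 + (s + i) + 1 = 2 * (s + i) + (2 * m + 1 - 1 - i) by omega, pow_add, pow_mul]
        simp
      rw [show n - (2 * m + 1 - 1 - i) = s + i by omega, ← hpar, ← mul_assoc, ← pow_add, pow_succ]
      ring
    have h3 : (-1) ^ (n - 1) * ∑ i ∈ Finset.range (N + 1), (-1) ^ (n + 1 + i) * T (n + 1 + i) =
        ∑ i ∈ Finset.range (N + 1), (-1) ^ i * T (n + 1 + i) := by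
      rw [Finset.mul_sum]
      refine Finset.sum_congr rfl fun i _ => ?_
      rw [← mul_assoc, ← pow_add, show n - 1 + (n + 1 + i) = 2 * n + i by omega, pow_add, pow_mul]
      simp
    have h4 : T (n + 1) - T (n + 1 + 1) ≤ ∑ i ∈ Finset.range (N + 1), (-1) ^ i * T (n + 1 + i) := by
      rw [Finset.sum_range_succ']
      have h5 := (alternating_sum_mem_Icc N (fun i => T (n + 1 + (i + 1))) (fun i _ => (hT0 _).le)
        (fun i _ => hdown (n + 1 + (i + 1)) (by omega))).2
      have h6 : ∑ i ∈ Finset.range N, (-1) ^ (i + 1) * T (n + 1 + (i + 1)) =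
          -∑ i ∈ Finset.range N, (-1) ^ i * T (n + 1 + (i + 1)) := by
        rw [← Finset.sum_neg_distrib]
        refine Finset.sum_congr rfl fun i _ => by ring
      rw [h6]
      have h7 : ∑ i ∈ Finset.range N, (-1) ^ i * T (n + 1 + (i + 1)) ≤ T (n + 1 + 1) := by
        rcases Nat.eq_zero_or_pos N with rfl | hN
        · simpa using (hT0 _).le
        · exact h5 hN
      simp
      linarith
    rw [hs1, mul_add, mul_add, h2, h3]
    linarith
  have hlim : Filter.Tendsto
      (fun N => (-1 : ℝ) ^ (n - 1) * ∑ j ∈ Finset.range (n + 1 + (N + 1)), (-1) ^ j * T j)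
      Filter.atTop (nhds ((-1) ^ (n - 1) * g (-y))) := by
    have h1 := (hg (-y)).tendsto_sum_nat
    have h2 : (fun k => a k * (-y) ^ k) = fun j => (-1) ^ j * T j := by
      funext j; simp only [hT]; rw [neg_pow]; ring
    rw [h2] at h1
    refine (h1.comp ?_).const_mul _
    exact Filter.tendsto_atTop_mono (fun N => show N ≤ n + 1 + (N + 1) by omega) Filter.tendsto_id
  have := ge_of_tendsto' hlim hpart
  linarith

end CoeffRatio

/-! ### Jensen's inequality and the count of nonreal zeros. -/

/-- The sum of an everywhere convergent power series is entire. -/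
theorem analyticAt_of_hasSum {c : ℕ → ℂ} {f : ℂ → ℂ} (hf : ∀ z, HasSum (fun k => c k * z ^ k) (f z))
    (z : ℂ) : AnalyticAt ℂ f z := by
  have hr : (FormalMultilinearSeries.ofScalars ℂ c).radius = ⊤ := by
    refine FormalMultilinearSeries.radius_eq_top_of_summable_norm _ fun r => ?_
    refine ((hf (r : ℂ)).summable.norm).congr fun k => ?_
    rw [FormalMultilinearSeries.ofScalars_norm, norm_mul, norm_pow]
    simp
  have hb : HasFPowerSeriesOnBall f (FormalMultilinearSeries.ofScalars ℂ c) 0 ⊤ := by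
    refine ⟨hr.ge, by simp, fun {y} _ => ?_⟩
    simpa [FormalMultilinearSeries.ofScalars_apply_eq, mul_comm] using hf y
  exact hb.analyticAt_of_mem (by simp)

/-- The values on the real axis of a power series with real coefficients. -/
theorem hasSum_re_of_hasSum_ofReal {a : ℕ → ℝ} {f : ℂ → ℂ}
    (hf : ∀ z : ℂ, HasSum (fun k : ℕ => (a k : ℂ) * z ^ k) (f z)) (x : ℝ) :
    HasSum (fun k => a k * x ^ k) (f x).re := by
  refine (Complex.reCLM.hasSum (hf x)).congr_fun fun k => ?_
  rw [Complex.reCLM_apply, ← Complex.ofReal_pow, ← Complex.ofReal_mul, Complex.ofReal_re]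

open Metric MeromorphicOn in
/-- Jensen's inequality for a finite set of zeros. -/
theorem sum_order_mul_log_le {f : ℂ → ℂ} (hf : ∀ z, AnalyticAt ℂ f z) (h0 : f 0 ≠ 0) {R M : ℝ}
    (hR : 0 < R) (hM : 1 ≤ M) (hbound : ∀ z : ℂ, ‖z‖ = R → ‖f z‖ ≤ M) (S : Finset ℂ)
    (hS : ∀ w ∈ S, ‖w‖ ≤ R) :
    ∑ w ∈ S, ((analyticOrderAt f w).toNat : ℝ) * Real.log (R / ‖w‖) + Real.log ‖f 0‖ ≤
      Real.log M := by
  have hfa : AnalyticOnNhd ℂ f (closedBall 0 |R|) := fun z _ => hf z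
  have habs : |R| = R := abs_of_pos hR
  have jensen := hfa.circleAverage_log_norm hR.ne' h0
  have hle : Real.circleAverage (fun x => Real.log ‖f x‖) 0 R ≤ Real.log M := by
    apply Real.circleAverage_mono_on_of_le_circle
    · exact (hfa.mono sphere_subset_closedBall).meromorphicOn.circleIntegrable_log_norm
    · intro z hz
      have hz' : ‖z‖ = R := by simpa [habs] using hz
      -- At a zero on the circle `Real.log 0 = 0`, and `1 ≤ M` gives the bound.
      rcases eq_or_ne (f z) 0 with h | h
      · simpa [h] using Real.log_nonneg hM
      · exact Real.log_le_log (norm_pos_iff.2 h) (hbound z hz')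
  set D := divisor f (closedBall (0 : ℂ) |R|) with hD
  have hdiv : ∀ w, ‖w‖ ≤ R → (D w : ℝ) = ((analyticOrderAt f w).toNat : ℝ) := by
    intro w hw
    rw [hD, hfa.divisor_apply (by simpa [habs] using hw)]
    induction h : analyticOrderAt f w using ENat.recTopCoe with
    | top => simp
    | coe n => simp
  have hlog : ∀ w : ℂ, ‖w‖ ≤ R → 0 ≤ Real.log (R * ‖(0 : ℂ) - w‖⁻¹) := by
    intro w hw
    rcases eq_or_ne w 0 with rfl | h
    · simp
    · rw [zero_sub, norm_neg, ← div_eq_mul_inv]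
      exact Real.log_nonneg ((one_le_div (norm_pos_iff.2 h)).2 hw)
  have hnn : ∀ w, 0 ≤ (D w : ℝ) * Real.log (R * ‖(0 : ℂ) - w‖⁻¹) := by
    intro w
    by_cases hw : ‖w‖ ≤ R
    · exact mul_nonneg (by rw [hdiv w hw]; positivity) (hlog w hw)
    · have : D w = 0 := Function.locallyFinsuppWithin.apply_eq_zero_of_notMem _
        (by simpa [habs] using hw)
      simp [this]
  have hfin : (Function.support D).Finite := D.finiteSupport (isCompact_closedBall _ _)
  have hsupp : Function.support (fun w => (D w : ℝ) * Real.log (R * ‖(0 : ℂ) - w‖⁻¹)) ⊆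
      ((hfin.toFinset ∪ S : Finset ℂ) : Set ℂ) := by
    intro w hw
    have : D w ≠ 0 := by
      intro h; apply hw; simp [h]
    simp [this]
  rw [finsum_eq_sum_of_support_subset _ hsupp] at jensen
  have hsum : ∑ w ∈ S, ((analyticOrderAt f w).toNat : ℝ) * Real.log (R / ‖w‖) ≤
      ∑ w ∈ hfin.toFinset ∪ S, (D w : ℝ) * Real.log (R * ‖(0 : ℂ) - w‖⁻¹) := by
    calc _ = ∑ w ∈ S, (D w : ℝ) * Real.log (R * ‖(0 : ℂ) - w‖⁻¹) := by
          refine Finset.sum_congr rfl fun w hw => ?_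
          rw [hdiv w (hS w hw), zero_sub, norm_neg, div_eq_mul_inv]
      _ ≤ _ := Finset.sum_le_sum_of_subset_of_nonneg Finset.subset_union_right fun w _ _ => hnn w
  linarith

/-- At `r = a_{K-1} / a_K` the sum of a power series with second quotients at least `2` is at most
four times its largest term. -/
theorem tsum_le_four_mul {a : ℕ → ℝ} (ha : ∀ k, 0 < a k) {v : ℝ} (hq2 : 2 ≤ secondQuotient a 2)
    (hmono : ∀ n : ℕ, 2 ≤ n → secondQuotient a n ≤ secondQuotient a (n + 1)) {K : ℕ} (hK : 1 ≤ K)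
    (hv : HasSum (fun k => a k * coeffRatio a K ^ k) v) : v ≤ 4 * (a K * coeffRatio a K ^ K) := by
  set R := coeffRatio a K with hR
  have hR0 : 0 < R := coeffRatio_pos ha K
  set T : ℕ → ℝ := fun k => a k * R ^ k with hT
  have hT0 : ∀ k, 0 < T k := fun k => mul_pos (ha k) (pow_pos hR0 k)
  have hstep : ∀ k, T (k + 1) * coeffRatio a (k + 1) = T k * R := by
    intro k
    simp only [hT]
    rw [← mul_coeffRatio_succ ha k, pow_succ]; ring
  have hup : ∀ k, k + 2 ≤ K → 2 * T k ≤ T (k + 1) := by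
    intro k hk
    have h1 := two_mul_coeffRatio_le ha hq2 hmono (show 1 ≤ k + 1 by omega)
    have h2 : coeffRatio a (k + 1 + 1) ≤ R := coeffRatio_le ha hq2 hmono (by omega) hk
    have h3 := coeffRatio_pos ha (k + 1)
    have h4 : T (k + 1) * coeffRatio a (k + 1) ≥ T k * (2 * coeffRatio a (k + 1)) := by
      rw [hstep]; exact mul_le_mul_of_nonneg_left (h1.trans h2) (hT0 k).le
    exact le_of_mul_le_mul_right (by linarith) h3
  have hdown : ∀ k, K ≤ k → T (k + 1) ≤ T k / 2 := by
    intro k hk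
    have h1 := two_mul_coeffRatio_le ha hq2 hmono (show 1 ≤ k by omega)
    have h2 : R ≤ coeffRatio a k := coeffRatio_le ha hq2 hmono hK hk
    have h4 : T (k + 1) * (2 * R) ≤ T k * R := by
      rw [← hstep]; exact mul_le_mul_of_nonneg_left (by linarith) (hT0 _).le
    have := le_of_mul_le_mul_right (show (T (k + 1) * 2) * R ≤ T k * R by linarith) hR0
    linarith
  -- The terms of index `K - 1` and `K` are equal; below them terms at least double, above them they
  -- at least halve. Head and tail are each at most `2 * T K`.
  have hhead : ∀ n, n + 1 ≤ K → ∑ k ∈ Finset.range (n + 1), T k ≤ 2 * T n := by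
    intro n
    induction n with
    | zero => intro _; have := hT0 0; simp; linarith
    | succ n ih =>
      intro hn
      rw [Finset.sum_range_succ]
      linarith [ih (by omega), hup n (by omega)]
  have hKK : T (K - 1) = T K := by
    have := hstep (K - 1)
    rw [show K - 1 + 1 = K by omega] at this
    exact (mul_right_cancel₀ hR0.ne' this).symm
  have htail : ∀ n, T (n + K) ≤ T K * (1 / 2) ^ n := by
    intro n
    induction n with
    | zero => simp
    | succ n ih =>
      have := hdown (n + K) (by omega)
      rw [show n + 1 + K = n + K + 1 by ring, pow_succ]
      linarith
  have hsplit := hv.summable.sum_add_tsum_nat_add K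
  have h1 := hhead (K - 1) (by omega)
  rw [show K - 1 + 1 = K by omega, hKK] at h1
  have h2 : ∑' n, T (n + K) ≤ T K * 2 := by
    rw [← tsum_geometric_two, ← tsum_mul_left]
    exact ((summable_nat_add_iff K).2 hv.summable).tsum_le_tsum htail
      (summable_geometric_two.mul_left _)
  rw [hv.tsum_eq] at hsplit
  change v ≤ 4 * T K
  linarith

theorem tendsto_coeffRatio_atTop {a : ℕ → ℝ} (ha : ∀ k, 0 < a k) (hq2 : 2 ≤ secondQuotient a 2)
    (hmono : ∀ n : ℕ, 2 ≤ n → secondQuotient a n ≤ secondQuotient a (n + 1)) :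
    Filter.Tendsto (coeffRatio a) Filter.atTop Filter.atTop := by
  have h : ∀ n, coeffRatio a 1 * 2 ^ n ≤ coeffRatio a (n + 1) := by
    intro n
    induction n with
    | zero => simp
    | succ n ih =>
      have := two_mul_coeffRatio_le ha hq2 hmono (show 1 ≤ n + 1 by omega)
      rw [pow_succ]; linarith
  rw [← Filter.tendsto_add_atTop_iff_nat 1]
  exact Filter.tendsto_atTop_mono h
    ((tendsto_pow_atTop_atTop_of_one_lt one_lt_two).const_mul_atTop (coeffRatio_pos ha 1))

/-- Telescoping of the term ratios `R / p (j+1)`. The result has the shape of Jensen's sum, with the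
`p (j+1)` in place of the moduli of zeros. -/
theorem log_largest_term {a : ℕ → ℝ} (ha : ∀ k, 0 < a k) {R : ℝ} (hR : 0 < R) (K : ℕ) :
    Real.log (a K * R ^ K) =
      Real.log (a 0) + ∑ j ∈ Finset.range K, Real.log (R / coeffRatio a (j + 1)) := by
  induction K with
  | zero => simp
  | succ K ih =>
    have hp := coeffRatio_pos ha (K + 1)
    rw [Finset.sum_range_succ, ← add_assoc, ← ih, ← Real.log_mul
      (mul_pos (ha K) (pow_pos hR K)).ne' (div_pos hR hp).ne']
    congr 1
    rw [← mul_coeffRatio_succ ha K, pow_succ]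
    field_simp

/-- An entire function with increasing second quotients has at most `N` nonreal zeros, if it has
real zeros `ξ i` with `|ξ i| ≤ a_{N+i} / a_{N+i+1}`. -/
theorem sum_order_nonreal_le {a : ℕ → ℝ} {f : ℂ → ℂ} (ha : ∀ k, 0 < a k)
    (hf : ∀ z : ℂ, HasSum (fun k : ℕ => (a k : ℂ) * z ^ k) (f z))
    (hq2 : 2 ≤ secondQuotient a 2)
    (hmono : ∀ n : ℕ, 2 ≤ n → secondQuotient a n ≤ secondQuotient a (n + 1)) {N : ℕ}
    (ξ : ℕ → ℝ) (hinj : Function.Injective ξ) (hξ : ∀ i, f (ξ i) = 0)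
    (hξle : ∀ i, |ξ i| ≤ coeffRatio a (N + i + 1))
    (hord : ∀ w, analyticOrderAt f w ≠ ⊤) (A : Finset ℂ) (hA : ↑A ⊆ nonrealZeros f) :
    ∑ w ∈ A, (analyticOrderAt f w).toNat ≤ N := by
  have hfa := analyticAt_of_hasSum hf
  have hf0 : f 0 = a 0 := by
    have := hasSum_single (f := fun k : ℕ => (a k : ℂ) * 0 ^ k) 0 (by intro k hk; simp [hk])
    simpa using (hf 0).unique this
  have hA0 : ∀ w ∈ A, w ≠ 0 := by
    rintro w hw rfl
    exact (hA hw).2 (by simp)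
  have hξ0 : ∀ i, ξ i ≠ 0 := by
    intro i h
    have := hξ i
    rw [h, Complex.ofReal_zero, hf0] at this
    exact (ha 0).ne' (by exact_mod_cast this)
  have hξord : ∀ i, 1 ≤ (analyticOrderAt f (ξ i)).toNat := by
    intro i
    rw [Nat.one_le_iff_ne_zero]
    intro h
    rcases ENat.toNat_eq_zero.1 h with h | h
    · exact (hfa _).analyticOrderAt_eq_zero.1 h (hξ i)
    · exact hord _ h
  have hp := tendsto_coeffRatio_atTop ha hq2 hmono
  set o : ℂ → ℝ := fun w => ((analyticOrderAt f w).toNat : ℝ) with ho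
  by_contra! hlt
  have hlt' : (N : ℝ) + 1 ≤ ∑ w ∈ A, o w := by
    simp only [ho]; exact_mod_cast hlt
  -- Everything in the final inequality that does not depend on `R`: it will read `(∑ o w) log R ≤ N
  -- log R + C`.
  set C : ℝ := Real.log 4 - ∑ j ∈ Finset.range N, Real.log (coeffRatio a (j + 1)) +
    ∑ w ∈ A, o w * Real.log ‖w‖ with hC
  obtain ⟨B, hB⟩ : ∃ B : ℝ, ∀ w ∈ A, ‖w‖ ≤ B :=
    ⟨∑ w ∈ A, ‖w‖, fun w hw => Finset.single_le_sum (fun v _ => norm_nonneg v) hw⟩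
  -- The radius must enclose `A`, make the term of index `K` at least `1` (hence `(a 1)⁻¹`), and
  -- satisfy `log R > C` for the contradiction.
  obtain ⟨L, hL1, hLB, hLa, hLC⟩ : ∃ L, 1 ≤ coeffRatio a (N + L) ∧ B ≤ coeffRatio a (N + L) ∧
      (a 1)⁻¹ ≤ coeffRatio a (N + L) ∧ Real.exp C < coeffRatio a (N + L) ∧ 1 ≤ L := by
    have h := (Filter.tendsto_add_atTop_iff_nat N).2 hp
    have := (((((h.eventually_ge_atTop 1).and (h.eventually_ge_atTop B)).and
      (h.eventually_ge_atTop (a 1)⁻¹)).and (h.eventually_gt_atTop (Real.exp C))).and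
      (Filter.eventually_ge_atTop 1)).exists
    obtain ⟨L, ⟨⟨⟨h1, h2⟩, h3⟩, h4⟩, h5⟩ := this
    rw [add_comm] at h1 h2 h3 h4
    exact ⟨L, h1, h2, h3, h4, h5⟩
  obtain ⟨hLC, hL⟩ := hLC
  set K := N + L with hK
  set R := coeffRatio a K with hR
  have hR0 : 0 < R := by linarith
  have hsumR : HasSum (fun k => a k * R ^ k) (f R).re := hasSum_re_of_hasSum_ofReal hf R
  have hbound : ∀ z : ℂ, ‖z‖ = R → ‖f z‖ ≤ 4 * (a K * R ^ K) := by
    intro z hz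
    refine le_trans ?_ (tsum_le_four_mul ha hq2 hmono (by omega) hsumR)
    rw [← (hf z).tsum_eq]
    refine tsum_of_norm_bounded hsumR fun k => ?_
    rw [norm_mul, norm_pow, hz, Complex.norm_real, Real.norm_of_nonneg (ha k).le]
  have hT1 : 1 ≤ a K * R ^ K := by
    have hmon : ∀ k, k + 1 ≤ K → a 1 * R ≤ a (k + 1) * R ^ (k + 1) := by
      intro k
      induction k with
      | zero => simp
      | succ k ih =>
        intro hk
        refine (ih (by omega)).trans ?_
        rw [← mul_coeffRatio_succ ha (k + 1), pow_succ _ (k + 1), mul_assoc, mul_comm (R ^ (k + 1))]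
        refine mul_le_mul_of_nonneg_left ?_ (ha _).le
        exact mul_le_mul_of_nonneg_right (coeffRatio_le ha hq2 hmono (by omega) hk) (by positivity)
    have h1 := hmon (K - 1) (by omega)
    rw [show K - 1 + 1 = K by omega] at h1
    refine le_trans ?_ h1
    calc (1 : ℝ) = a 1 * (a 1)⁻¹ := (mul_inv_cancel₀ (ha 1).ne').symm
      _ ≤ a 1 * R := mul_le_mul_of_nonneg_left hLa (ha 1).le
  set Ξ : Finset ℂ := (Finset.range L).image fun i => ((ξ i : ℝ) : ℂ) with hΞ
  have hdisj : Disjoint A Ξ := by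
    rw [Finset.disjoint_left]
    intro w hw hw'
    obtain ⟨i, -, rfl⟩ := Finset.mem_image.1 hw'
    exact (hA hw).2 (by simp)
  have hξR : ∀ i < L, coeffRatio a (N + i + 1) ≤ R := fun i hi =>
    coeffRatio_le ha hq2 hmono (by omega) (by omega)
  have hJ := sum_order_mul_log_le hfa (by rw [hf0]; exact_mod_cast (ha 0).ne') hR0
    (show 1 ≤ 4 * (a K * R ^ K) by linarith) hbound (A ∪ Ξ) (by
      intro w hw
      rcases Finset.mem_union.1 hw with hw | hw
      · exact (hB w hw).trans hLB
      · obtain ⟨i, hi, rfl⟩ := Finset.mem_image.1 hw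
        rw [Complex.norm_real]
        exact (hξle i).trans (hξR i (Finset.mem_range.1 hi)))
  rw [Finset.sum_union hdisj, hf0, Complex.norm_real, Real.norm_of_nonneg (ha 0).le,
    Finset.sum_image (fun i _ j _ h => hinj (Complex.ofReal_injective h)),
    Real.log_mul (by norm_num) (by linarith), log_largest_term ha hR0, hK,
    Finset.sum_range_add] at hJ
  have h1 : ∑ i ∈ Finset.range L, Real.log (R / coeffRatio a (N + i + 1)) ≤
      ∑ i ∈ Finset.range L,
        ((analyticOrderAt f (ξ i)).toNat : ℝ) * Real.log (R / ‖((ξ i : ℝ) : ℂ)‖) := by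
    refine Finset.sum_le_sum fun i hi => ?_
    have hi' := Finset.mem_range.1 hi
    have hpos : 0 < |ξ i| := abs_pos.2 (hξ0 i)
    have hp' := coeffRatio_pos ha (N + i + 1)
    rw [Complex.norm_real, Real.norm_eq_abs]
    have h2 : Real.log (R / coeffRatio a (N + i + 1)) ≤ Real.log (R / |ξ i|) :=
      Real.log_le_log (div_pos hR0 hp') (div_le_div_of_nonneg_left hR0.le hpos (hξle i))
    have h3 : 0 ≤ Real.log (R / coeffRatio a (N + i + 1)) :=
      Real.log_nonneg ((one_le_div hp').2 (hξR i hi'))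
    refine h2.trans (le_mul_of_one_le_left (h3.trans h2) ?_)
    exact_mod_cast hξord i
  have h2 : ∑ w ∈ A, o w * Real.log (R / ‖w‖) =
      (∑ w ∈ A, o w) * Real.log R - ∑ w ∈ A, o w * Real.log ‖w‖ := by
    rw [Finset.sum_mul, ← Finset.sum_sub_distrib]
    refine Finset.sum_congr rfl fun w hw => ?_
    rw [Real.log_div hR0.ne' (norm_ne_zero_iff.2 (hA0 w hw))]; ring
  have h3 : ∑ j ∈ Finset.range N, Real.log (R / coeffRatio a (j + 1)) =
      N * Real.log R - ∑ j ∈ Finset.range N, Real.log (coeffRatio a (j + 1)) := by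
    have : (N : ℝ) * Real.log R = ∑ j ∈ Finset.range N, Real.log R := by simp
    rw [this, ← Finset.sum_sub_distrib]
    refine Finset.sum_congr rfl fun j _ => ?_
    rw [Real.log_div hR0.ne' (coeffRatio_pos ha _).ne']
  have h4 : C < Real.log R := (Real.lt_log_iff_exp_lt hR0).2 hLC
  have h5 : 0 ≤ Real.log R := Real.log_nonneg hL1
  rw [h2, h3] at hJ
  have h6 := mul_le_mul_of_nonneg_right hlt' h5
  linarith

/-! ### The theorem. -/

theorem theorem2 (a : ℕ → ℝ) (f : ℂ → ℂ)
    (ha : ∀ k, 0 < a k)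
    (hf : ∀ z : ℂ, HasSum (fun k : ℕ => (a k : ℂ) * z ^ k) (f z))
    (hq2 : 2 * (2 : ℝ) ^ ((1 : ℝ) / 3) ≤ secondQuotient a 2)
    (hmono : ∀ n : ℕ, 2 ≤ n → secondQuotient a n ≤ secondQuotient a (n + 1))
    (j₀ m₀ : ℕ) (hj₀ : 2 ≤ j₀) (hm₀ : 1 ≤ m₀)
    (hc : thetaConst (2 * m₀) ≤ secondQuotient a j₀) :
    (nonrealZeros f).Finite ∧
      (∑ᶠ z ∈ nonrealZeros f, analyticOrderAt f z) ≤ ((j₀ + 2 * m₀ - 2 : ℕ) : ℕ∞) := by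
  have hq2' : 2 ≤ secondQuotient a 2 := by
    have : (1 : ℝ) ≤ (2 : ℝ) ^ ((1 : ℝ) / 3) := Real.one_le_rpow one_le_two (by norm_num)
    linarith
  have hfa := analyticAt_of_hasSum hf
  set g : ℝ → ℝ := fun x => (f x).re with hg
  have hgsum : ∀ x, HasSum (fun k => a k * x ^ k) (g x) := hasSum_re_of_hasSum_ofReal hf
  have hfg : ∀ x : ℝ, f x = g x := by
    intro x
    have h := Complex.hasSum_ofReal.2 (hgsum x)
    push_cast at h
    exact (hf x).unique h
  have hgcont : Continuous g := by
    have : Continuous f := continuous_iff_continuousAt.2 fun z => (hfa z).continuousAt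
    exact Complex.continuous_re.comp (this.comp Complex.continuous_ofReal)
  have hord : ∀ w, analyticOrderAt f w ≠ ⊤ := by
    intro w hw
    rw [analyticOrderAt_eq_top] at hw
    have h1 : f = fun _ => 0 := AnalyticOnNhd.eq_of_eventuallyEq (fun z _ => hfa z)
      (fun z _ => analyticAt_const) hw
    have h2 := le_hasSum (hgsum 0) 0 fun k _ => mul_nonneg (ha k).le (pow_nonneg le_rfl k)
    have h3 := ha 0
    simp [hg, h1] at h2
    linarith
  obtain ⟨ht, u, hu1, hut, hW⟩ := exists_thetaWindow_nonpos (show 2 ≤ 2 * m₀ by omega)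
  -- The block starts at `s = j₀ - 2 + i`, so the smallest second quotient it involves has index `j₀
  -- + i ≥ j₀`.
  have hsign : ∀ i, ∃ y, coeffRatio a (j₀ - 2 + i + 2 * m₀ - 1) ≤ y ∧
      y ≤ coeffRatio a (j₀ - 2 + i + 2 * m₀) ∧
      0 < (-1) ^ (j₀ - 2 + i + 2 * m₀ - 1) * g (-y) := fun i =>
    exists_sign_pos ha hgsum hq2' hmono hm₀ ht hu1 hut hW
      (hc.trans (secondQuotient_le hmono hj₀ (by omega)))
  choose y hy1 hy2 hy3 using hsign
  have hyy : ∀ i, y i ≤ y (i + 1) := by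
    intro i
    refine (hy2 i).trans (le_trans (le_of_eq ?_) (hy1 (i + 1)))
    congr 1; omega
  have hzero : ∀ i, ∃ ξ ∈ Set.Ioo (-y (i + 1)) (-y i), g ξ = 0 := by
    intro i
    refine exists_zero_of_alternating hgcont (neg_le_neg (hyy i)) (hy3 i) ?_
    have := hy3 (i + 1)
    rwa [show j₀ - 2 + (i + 1) + 2 * m₀ - 1 = j₀ - 2 + i + 2 * m₀ - 1 + 1 by omega] at this
  choose ξ hξ hξ0 using hzero
  have hanti : StrictAnti ξ := strictAnti_nat_of_succ_lt fun i => (hξ (i + 1)).2.trans (hξ i).1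
  have hbound : ∀ A : Finset ℂ, ↑A ⊆ nonrealZeros f →
      ∑ w ∈ A, (analyticOrderAt f w).toNat ≤ j₀ + 2 * m₀ - 2 := by
    refine sum_order_nonreal_le ha hf hq2' hmono ξ hanti.injective
      (fun i => by rw [hfg, hξ0, Complex.ofReal_zero]) (fun i => ?_) hord
    have h0 : 0 < y i := (coeffRatio_pos ha _).trans_le (hy1 i)
    rw [abs_of_neg (by linarith [(hξ i).2])]
    -- The outer endpoint `y (i + 1)` is at most `p (N + i + 1)`, which fixes the value of `N`.
    have h1 := hy2 (i + 1)
    rw [show j₀ - 2 + (i + 1) + 2 * m₀ = j₀ + 2 * m₀ - 2 + i + 1 by omega] at h1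
    linarith [(hξ i).1]
  have hone : ∀ w ∈ nonrealZeros f, 1 ≤ (analyticOrderAt f w).toNat := by
    intro w hw
    rw [Nat.one_le_iff_ne_zero]
    intro h
    rcases ENat.toNat_eq_zero.1 h with h | h
    · exact (hfa _).analyticOrderAt_eq_zero.1 h hw.1
    · exact hord _ h
  have hfin : (nonrealZeros f).Finite := by
    by_contra hinf
    obtain ⟨A, hA, hcard⟩ := Set.Infinite.exists_subset_card_eq hinf (j₀ + 2 * m₀ - 2 + 1)
    have h1 := hbound A hA
    have h2 := Finset.card_nsmul_le_sum A (fun w => (analyticOrderAt f w).toNat) 1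
      fun w hw => hone w (hA hw)
    rw [hcard] at h2
    simp only [smul_eq_mul, mul_one] at h2
    omega
  refine ⟨hfin, ?_⟩
  rw [finsum_mem_eq_finite_toFinset_sum _ hfin]
  have h := hbound hfin.toFinset (by simp)
  calc ∑ w ∈ hfin.toFinset, analyticOrderAt f w
      = ∑ w ∈ hfin.toFinset, ((analyticOrderAt f w).toNat : ℕ∞) :=
        Finset.sum_congr rfl fun w _ => (ENat.natCast_toNat (hord w)).symm
    _ = ((∑ w ∈ hfin.toFinset, (analyticOrderAt f w).toNat : ℕ) : ℕ∞) := by push_cast; rfl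
    _ ≤ _ := by exact_mod_cast h
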